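/- Let $E$ be a real Banach space with dual space $E'$, and let $B_{E'}=\{f\in E' : \|f\|_{E'}\le 1\}$ be the closed unit ball of the dual. Let $(\Omega,\mathcal A,\mathbb P)$ be a complete probability space with expectation $\mathbb E$, let $M\in\mathbb N$, and let $g_1,\dots,g_M$ be independent standard normal random variables on $\Omega$. Let $\Psi\colon\mathbb R^2\to\mathbb R$ be continuous with $\Psi(0,0)=0$, let $x_1,\dots,x_M,y_1,\dots,y_M\in E$, and define $$\mathcal G_1(f):=\sum_{j=1}^M g_j\,\Psi\bigl(f(x_j),f(y_j)\bigr),\qquad f\in B_{E'}.$$ Let $\mathcal G_2\colon B_{E'}\times\Omega\to\mathbb R$ be a centered Gaussian process on $(\Omega,\mathcal A,\mathbb P)$ such that $$\mathbb E\bigl[|\mathcal G_1(f)-\mathcal G_1(h)|^2\bigr]\le \mathbb E\bigl[|\mathcal G_2(f)-\mathcal G_2(h)|^2\bigr]\qquad\text{for all } f,h\in B_{E'}.$$ Then $\mathcal G_1$ is a centered Gaussian process, $\sup_{f\in B_{E'}}|\mathcal G_1(f)|$ is measurable, and for every $q\in[1,\infty)$ $$\mathbb E\Bigl[\bigl(\sup_{f\in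 B_{E'}}|\mathcal G_1(f)|\bigr)^q\Bigr]\le 2^q\,\mathbb E\Bigl[\bigl(\sup_{f\in B_{E'}}|\mathcal G_2(f)|\bigr)^q\Bigr],$$ where the suprema are taken pointwise on $\Omega$ with values in $[0,\infty]$, and both sides take values in $[0,\infty]$. If $\sup_{f\in B_{E'}}|\mathcal G_2(f)|$ is not measurable, the expectation on the right is understood as the lower integral, that is, the supremum of the integrals of the measurable functions below the integrand. -/

import Mathlib

open MeasureTheory ProbabilityTheory
open scoped ENNReal

/-- An orthogaussian family: independent real random variables, each with the standard normal
law `N(0,1)`. -/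
structure IsOrthogaussian {ι Ω : Type*} [MeasurableSpace Ω] (g : ι → Ω → ℝ) (P : Measure Ω) :
    Prop where
  hasLaw : ∀ j, HasLaw (g j) (gaussianReal 0 1) P
  iIndepFun : iIndepFun g P

/-- A centered real Gaussian process: all finite-dimensional marginals are (possibly degenerate)
Gaussian, and each coordinate has expectation zero. -/
structure IsCenteredGaussianFamily {T Ω : Type*} [MeasurableSpace Ω] (G : T → Ω → ℝ)
    (P : Measure Ω) : Prop where
  isGaussianProcess : IsGaussianProcess G P
  integral_eq_zero : ∀ t, ∫ ω, G t ω ∂P = 0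

/-- The closed unit ball of the (normed) dual space of `E`. -/
abbrev DualUnitBall (E : Type*) [NormedAddCommGroup E] [NormedSpace ℝ E] : Type _ :=
  Metric.closedBall (0 : StrongDual ℝ E) 1

/-- The process `f ↦ ∑ j, g j * Ψ (f (x j), f (y j))` indexed by the dual unit ball. -/
def gaussianSum {E Ω : Type*} [NormedAddCommGroup E] [NormedSpace ℝ E] {M : ℕ}
    (g : Fin M → Ω → ℝ) (Ψ : ℝ × ℝ → ℝ) (x y : Fin M → E) (f : DualUnitBall E) (ω : Ω) : ℝ :=
  ∑ j, g j ω * Ψ (f.1 (x j), f.1 (y j))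

/-- The pointwise supremum `sup_t |G t ω|`, as an element of `[0, ∞]`. -/
noncomputable def supAbs {T Ω : Type*} (G : T → Ω → ℝ) (ω : Ω) : ℝ≥0∞ :=
  ⨆ t, ENNReal.ofReal |G t ω|

/-- **Stein's lemma** for the centered normal law on the line. -/
theorem integral_mul_gaussianReal_eq {v : NNReal} {h h' : ℝ → ℝ} {C : ℝ}
    (hd : ∀ x, HasDerivAt h (h' x) x) (hC : ∀ x, |h x| ≤ C) (hC' : ∀ x, |h' x| ≤ C) :
    ∫ x, x * h x ∂(gaussianReal 0 v) = v * ∫ x, h' x ∂(gaussianReal 0 v) := by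
  by_cases hv : v = 0
  · subst hv; simp
  have hv' : (v : ℝ) ≠ 0 := by exact_mod_cast hv
  have hcont : Continuous h := continuous_iff_continuousAt.2 fun x => (hd x).continuousAt
  have hm' : Measurable h' := by
    have : h' = deriv h := funext fun x => (hd x).deriv.symm
    rw [this]; exact measurable_deriv h
  set p := gaussianPDFReal 0 v with hp
  have hpd : ∀ x, HasDerivAt p (-(x / v) * p x) x := by
    intro x
    have h1 : HasDerivAt (fun x : ℝ => -(x - 0) ^ 2 / (2 * v)) (-(x / v)) x := by
      have := (((hasDerivAt_id x).sub_const 0).pow 2).neg.div_const (2 * (v : ℝ))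
      refine this.congr_deriv ?_
      simp; field_simp
    have := (h1.exp).const_mul ((√(2 * Real.pi * v))⁻¹)
    rw [hp, gaussianPDFReal_def]
    refine this.congr_deriv ?_
    ring
  have hpi : Integrable p := integrable_gaussianPDFReal 0 v
  have hxp : Integrable (fun x => x * p x) := by
    have h1 : Integrable (fun x : ℝ => x) (gaussianReal 0 v) :=
      IsGaussian.integrable_id (μ := gaussianReal 0 v)
    rw [gaussianReal_of_var_ne_zero 0 hv, integrable_withDensity_iff_integrable_smul'
      (measurable_gaussianPDF 0 v) (by simp [gaussianPDF_lt_top])] at h1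
    refine h1.congr (ae_of_all _ fun x => ?_)
    simp [hp, mul_comm]
  have hhp : Integrable (fun x => h x * p x) :=
    hpi.bdd_mul hcont.aestronglyMeasurable (ae_of_all _ hC)
  have hh'p : Integrable (fun x => h' x * p x) :=
    hpi.bdd_mul hm'.aestronglyMeasurable (ae_of_all _ hC')
  have hhxp : Integrable (fun x => h x * (x * p x)) :=
    hxp.bdd_mul hcont.aestronglyMeasurable (ae_of_all _ hC)
  have key := integral_eq_zero_of_hasDerivAt_of_integrable (f := fun x => h x * p x)
    (f' := fun x => h' x * p x + -(v : ℝ)⁻¹ * (h x * (x * p x)))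
    (fun x => ((hd x).mul (hpd x)).congr_deriv (by ring))
    (hh'p.add (hhxp.const_mul _)) hhp
  rw [integral_add hh'p (hhxp.const_mul _), integral_const_mul] at key
  rw [integral_gaussianReal_eq_integral_smul hv, integral_gaussianReal_eq_integral_smul hv]
  have e1 : ∫ x, gaussianPDFReal 0 v x • (x * h x) = ∫ x, h x * (x * p x) := by
    congr 1; ext x; simp [hp]; ring
  have e2 : ∫ x, gaussianPDFReal 0 v x • h' x = ∫ x, h' x * p x := by
    congr 1; ext x; simp [hp]; ring
  rw [e1, e2]
  linear_combination (-(v : ℝ)) * key - (∫ x, h x * (x * p x)) * mul_inv_cancel₀ hv'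

/-- **Gaussian integration by parts** for a centered real variable and a vector that are jointly
Gaussian. -/
theorem integral_mul_comp_eq_of_hasGaussianLaw {ι Ω : Type*} [Fintype ι] [MeasurableSpace Ω]
    {P : Measure Ω} {ξ : Ω → ℝ} {Z : Ω → ι → ℝ}
    (hξZ : HasGaussianLaw (fun ω => (ξ ω, Z ω)) P) (hξ : ∫ ω, ξ ω ∂P = 0)
    {h : (ι → ℝ) → ℝ} {h' : (ι → ℝ) → (ι → ℝ) →L[ℝ] ℝ} {C : ℝ}
    (hd : ∀ z, HasFDerivAt h (h' z) z) (hc' : Continuous h')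
    (hC : ∀ z, |h z| ≤ C) (hC' : ∀ z, ‖h' z‖ ≤ C) :
    ∫ ω, ξ ω * h (Z ω) ∂P = ∫ ω, h' (Z ω) (fun j => cov[ξ, fun ω => Z ω j; P]) ∂P := by
  have hP := hξZ.isProbabilityMeasure
  have hξg : HasGaussianLaw ξ P := hξZ.fst
  have hZg : HasGaussianLaw Z P := hξZ.snd
  have hZj : ∀ j, MemLp (fun ω => Z ω j) 2 P := fun j =>
    (hZg.map_fun (ContinuousLinearMap.proj (R := ℝ) (φ := fun _ : ι => ℝ) j)).memLp_two
  have hξ2 : MemLp ξ 2 P := hξg.memLp_two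
  set κ : ι → ℝ := fun j => cov[ξ, fun ω => Z ω j; P] with hκ
  set V : ℝ := Var[ξ; P] with hV
  have hV0 : 0 ≤ V := variance_nonneg _ _
  set c : ι → ℝ := V⁻¹ • κ with hc
  have hκc : κ = V • c := by
    by_cases hV1 : V = 0
    · have h0 : ∀ᵐ ω ∂P, ξ ω = 0 := by
        have := ae_eq_integral_of_variance_eq_zero hξ2 hV1
        simpa [hξ] using this
      ext j
      simp only [hV1, zero_smul, Pi.zero_apply, hκ]
      rw [covariance, hξ]
      refine integral_eq_zero_of_ae ?_
      filter_upwards [h0] with ω hω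
      simp [hω]
    · rw [hc, smul_smul, mul_inv_cancel₀ hV1, one_smul]
  set W : Ω → ι → ℝ := fun ω => Z ω - ξ ω • c with hW
  have hWj : ∀ j, MemLp (fun ω => W ω j) 2 P := fun j => (hZj j).sub (hξ2.mul_const (c j))
  have hξW : HasGaussianLaw (fun ω => ((fun _ : Unit => ξ ω), fun j => W ω j)) P := by
    have := hξZ.map_fun (ContinuousLinearMap.prod
      (ContinuousLinearMap.pi (fun _ : Unit => ContinuousLinearMap.fst ℝ ℝ (ι → ℝ)))
      (ContinuousLinearMap.snd ℝ ℝ (ι → ℝ) -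
        (ContinuousLinearMap.fst ℝ ℝ (ι → ℝ)).smulRight c))
    exact this
  have hind' := hξW.indepFun_of_covariance_eval (X := fun _ : Unit => ξ)
    (Y := fun j ω => W ω j) (by
      intro _ j
      have : (fun ω => W ω j) = (fun ω => Z ω j) - fun ω => ξ ω * c j := by ext; simp [hW]
      rw [this, covariance_sub_right hξ2 (hZj j) (hξ2.mul_const _), covariance_mul_const_right,
        covariance_self hξ2.aemeasurable]
      have := congrFun hκc j
      simp only [Pi.smul_apply, smul_eq_mul] at this
      rw [← hV, ← this]
      simp [hκ])
  have hind : IndepFun ξ W P :=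
    hind'.comp (φ := fun x : Unit → ℝ => x ()) (ψ := id) (by fun_prop) measurable_id
  have hWm : AEMeasurable W P := hξW.snd.aemeasurable
  have hlaw : P.map (fun ω => (ξ ω, W ω)) = (gaussianReal 0 V.toNNReal).prod (P.map W) := by
    rw [(indepFun_iff_map_prod_eq_prod_map_map hξg.aemeasurable hWm).1 hind,
      hξg.map_eq_gaussianReal, hξ]
  have hcont : Continuous h := continuous_iff_continuousAt.2 fun x => (hd x).continuousAt
  have hprob : IsProbabilityMeasure (P.map W) := Measure.isProbabilityMeasure_map hWm
  have hZW : ∀ ω, Z ω = W ω + ξ ω • c := fun ω => by simp [hW]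
  have hpair : AEMeasurable (fun ω => (ξ ω, W ω)) P := hξg.aemeasurable.prodMk hWm
  have e1 : ∫ ω, ξ ω * h (Z ω) ∂P
      = ∫ w, ∫ x, x * h (w + x • c) ∂(gaussianReal 0 V.toNNReal) ∂(P.map W) := by
    rw [← integral_prod_symm (fun z : ℝ × (ι → ℝ) => z.1 * h (z.2 + z.1 • c)), ← hlaw,
      integral_map hpair (by fun_prop)]
    · simp [hZW]
    · refine Integrable.mul_bdd (c := C) (Integrable.comp_fst
        (IsGaussian.integrable_id (μ := gaussianReal 0 V.toNNReal)) _) (by fun_prop)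
        (ae_of_all _ fun z => hC _)
  have e2 : ∫ ω, h' (Z ω) κ ∂P
      = ∫ w, ∫ x, h' (w + x • c) κ ∂(gaussianReal 0 V.toNNReal) ∂(P.map W) := by
    rw [← integral_prod_symm (fun z : ℝ × (ι → ℝ) => h' (z.2 + z.1 • c) κ), ← hlaw,
      integral_map hpair (by fun_prop)]
    · simp [hZW]
    · refine Integrable.of_bound (C := C * ‖κ‖) (by fun_prop) (ae_of_all _ fun z => ?_)
      exact (ContinuousLinearMap.le_opNorm _ _).trans (by gcongr; exact hC' _)
  rw [e1, e2]
  congr 1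
  ext w
  rw [integral_mul_gaussianReal_eq (h' := fun x => h' (w + x • c) c) (C := max C (C * ‖c‖))]
  · rw [← integral_const_mul, Real.coe_toNNReal _ hV0]
    congr 1; ext x; rw [hκc]; simp
  · intro x
    have h1 : HasDerivAt (fun x : ℝ => w + x • c) c x := by
      simpa using ((hasDerivAt_id x).smul_const c).const_add w
    exact (hd _).comp_hasDerivAt x h1
  · exact fun x => (hC _).trans (le_max_left _ _)
  · intro x
    refine le_trans ?_ (le_max_right _ _)
    exact ((h' _).le_opNorm c).trans (mul_le_mul_of_nonneg_right (hC' _) (norm_nonneg c))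

/-- A symmetric matrix with vanishing row sums and nonpositive off-diagonal entries pairs
nonnegatively with any matrix `D` satisfying `2 D i j ≤ D i i + D j j`. -/
theorem sum_mul_nonneg_of_sum_eq_zero {ι : Type*} [Fintype ι] {H D : ι → ι → ℝ}
    (hsymm : ∀ i j, H i j = H j i) (hsum : ∀ i, ∑ j, H i j = 0)
    (hneg : ∀ i j, i ≠ j → H i j ≤ 0) (hD : ∀ i j, 2 * D i j ≤ D i i + D j j) :
    0 ≤ ∑ i, ∑ j, H i j * D i j := by
  have h1 : 0 ≤ ∑ i, ∑ j, (-H i j) * (D i i + D j j - 2 * D i j) := by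
    refine Finset.sum_nonneg fun i _ => Finset.sum_nonneg fun j _ => ?_
    by_cases hij : i = j
    · subst hij
      have : D i i + D i i - 2 * D i i = 0 := by ring
      simp [this]
    · exact mul_nonneg (neg_nonneg.2 (hneg i j hij)) (sub_nonneg.2 (hD i j))
  have h2 : ∑ i, ∑ j, H i j * D i i = 0 := by simp [← Finset.sum_mul, hsum]
  have h3 : ∑ i, ∑ j, H i j * D j j = 0 := by
    rw [Finset.sum_comm]
    simp_rw [hsymm _]
    rw [← h2]
  have h4 : ∑ i, ∑ j, (-H i j) * (D i i + D j j - 2 * D i j)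
      = 2 * (∑ i, ∑ j, H i j * D i j) - ∑ i, ∑ j, H i j * D i i - ∑ i, ∑ j, H i j * D j j := by
    simp only [Finset.mul_sum, ← Finset.sum_sub_distrib]
    refine Finset.sum_congr rfl fun i _ => Finset.sum_congr rfl fun j _ => by ring
  rw [h4, h2, h3] at h1
  linarith

/-- The linear form `v ↦ ∑ i, a i * v i`. -/
noncomputable def coordForm {ι : Type*} [Fintype ι] (a : ι → ℝ) : (ι → ℝ) →L[ℝ] ℝ :=
  ∑ i, a i • ContinuousLinearMap.proj (R := ℝ) (φ := fun _ : ι => ℝ) i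

@[simp] theorem coordForm_apply {ι : Type*} [Fintype ι] (a v : ι → ℝ) :
    coordForm a v = ∑ i, a i * v i := by
  simp [coordForm]

theorem norm_coordForm_le {ι : Type*} [Fintype ι] {a : ι → ℝ} {C : ℝ} (ha : ∀ i, |a i| ≤ C) :
    ‖coordForm a‖ ≤ Fintype.card ι * C := by
  have hs : ∑ i, |a i| ≤ Fintype.card ι * C := by
    simpa using Finset.sum_le_card_nsmul Finset.univ (fun i => |a i|) C fun i _ => ha i
  refine ContinuousLinearMap.opNorm_le_bound _
    ((Finset.sum_nonneg fun i _ => abs_nonneg _).trans hs) fun v => ?_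
  calc ‖coordForm a v‖ ≤ ∑ i, ‖a i * v i‖ := by rw [coordForm_apply]; exact norm_sum_le _ _
    _ ≤ ∑ i, |a i| * ‖v‖ := by
        refine Finset.sum_le_sum fun i _ => ?_
        rw [norm_mul, Real.norm_eq_abs]
        gcongr
        exact norm_le_pi_norm v i
    _ = (∑ i, |a i|) * ‖v‖ := by rw [Finset.sum_mul]
    _ ≤ _ := by gcongr

theorem continuous_coordForm {ι : Type*} [Fintype ι] {X : Type*} [TopologicalSpace X]
    {a : ι → X → ℝ} (ha : ∀ i, Continuous (a i)) : Continuous fun z => coordForm fun i => a i z := by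
  unfold coordForm
  fun_prop

section Interpolation

variable {ι : Type*} [Fintype ι] {μ ν : Measure (ι → ℝ)} [IsGaussian μ] [IsGaussian ν]

/-- Covariances along the rotation of a pair of independent centered Gaussian vectors. -/
theorem covariance_rotation (hμ : ∀ i, ∫ x, x i ∂μ = 0) (hν : ∀ i, ∫ x, x i ∂ν = 0)
    (s c : ℝ) (i j : ι) :
    cov[fun p : (ι → ℝ) × (ι → ℝ) => -s * p.1 i + c * p.2 i, fun p => c * p.1 j + s * p.2 j;
      μ.prod ν] = s * c * (∫ x, x i * x j ∂ν - ∫ x, x i * x j ∂μ) := by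
  have m1 : ∀ k, MemLp (fun x : ι → ℝ => x k) 2 μ := fun k =>
    IsGaussian.memLp_dual μ (ContinuousLinearMap.proj (R := ℝ) (φ := fun _ : ι => ℝ) k) 2 (by simp)
  have m2 : ∀ k, MemLp (fun x : ι → ℝ => x k) 2 ν := fun k =>
    IsGaussian.memLp_dual ν (ContinuousLinearMap.proj (R := ℝ) (φ := fun _ : ι => ℝ) k) 2 (by simp)
  have n1 : ∀ k, MemLp (fun p : (ι → ℝ) × (ι → ℝ) => p.1 k) 2 (μ.prod ν) :=
    fun k => (m1 k).comp_fst ν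
  have n2 : ∀ k, MemLp (fun p : (ι → ℝ) × (ι → ℝ) => p.2 k) 2 (μ.prod ν) :=
    fun k => (m2 k).comp_snd μ
  have c11 : ∀ k l, cov[fun p : (ι → ℝ) × (ι → ℝ) => p.1 k, fun p => p.1 l; μ.prod ν]
      = ∫ x, x k * x l ∂μ := fun k l => by
    rw [covariance_eq_sub (n1 k) (n1 l)]
    simp only [Pi.mul_apply]
    rw [integral_fun_fst (fun x : ι → ℝ => x k * x l), integral_fun_fst (fun x : ι → ℝ => x k)]
    simp [hμ]
  have c22 : ∀ k l, cov[fun p : (ι → ℝ) × (ι → ℝ) => p.2 k, fun p => p.2 l; μ.prod ν]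
      = ∫ x, x k * x l ∂ν := fun k l => by
    rw [covariance_eq_sub (n2 k) (n2 l)]
    simp only [Pi.mul_apply]
    rw [integral_fun_snd (fun x : ι → ℝ => x k * x l), integral_fun_snd (fun x : ι → ℝ => x k)]
    simp [hν]
  have c12 : ∀ k l, cov[fun p : (ι → ℝ) × (ι → ℝ) => p.1 k, fun p => p.2 l; μ.prod ν] = 0 :=
    fun k l => by
    rw [covariance_eq_sub (n1 k) (n2 l)]
    simp only [Pi.mul_apply]
    rw [integral_prod_mul (fun x : ι → ℝ => x k) (fun x : ι → ℝ => x l),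
      integral_fun_fst (fun x : ι → ℝ => x k)]
    simp [hμ]
  have c21 : ∀ k l, cov[fun p : (ι → ℝ) × (ι → ℝ) => p.2 k, fun p => p.1 l; μ.prod ν] = 0 :=
    fun k l => by rw [covariance_comm, c12]
  change cov[(fun p : (ι → ℝ) × (ι → ℝ) => -s * p.1 i) + fun p => c * p.2 i,
    (fun p => c * p.1 j) + fun p => s * p.2 j; μ.prod ν] = _
  rw [covariance_add_left ((n1 i).const_mul _) ((n2 i).const_mul _)
      (((n1 j).const_mul _).add ((n2 j).const_mul _)),
    covariance_add_right ((n1 i).const_mul _) ((n1 j).const_mul _) ((n2 j).const_mul _),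
    covariance_add_right ((n2 i).const_mul _) ((n1 j).const_mul _) ((n2 j).const_mul _)]
  simp only [covariance_const_mul_left, covariance_const_mul_right, c11, c12, c21, c22]
  ring

/-- **Gaussian comparison by interpolation.** A translation-invariant function with nonpositive
mixed second derivatives has a larger expectation under the centered Gaussian law with the larger
increments. -/
theorem integral_le_integral_of_increments_le
    (hμ : ∀ i, ∫ x, x i ∂μ = 0) (hν : ∀ i, ∫ x, x i ∂ν = 0)
    (hinc : ∀ i j, ∫ x, (x i - x j) ^ 2 ∂μ ≤ ∫ x, (x i - x j) ^ 2 ∂ν)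
    {f : (ι → ℝ) → ℝ} {g : ι → (ι → ℝ) → ℝ} {H : ι → ι → (ι → ℝ) → ℝ} {C : ℝ}
    (hf : ∀ z, HasFDerivAt f (coordForm fun i => g i z) z)
    (hg : ∀ i z, HasFDerivAt (g i) (coordForm fun j => H i j z) z)
    (hHc : ∀ i j, Continuous (H i j)) (hgC : ∀ i z, |g i z| ≤ C) (hHC : ∀ i j z, |H i j z| ≤ C)
    (hsymm : ∀ i j z, H i j z = H j i z) (hsum : ∀ i z, ∑ j, H i j z = 0)
    (hneg : ∀ i j, i ≠ j → ∀ z, H i j z ≤ 0) :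
    ∫ x, f x ∂μ ≤ ∫ x, f x ∂ν := by
  have hfc : Continuous f := continuous_iff_continuousAt.2 fun x => (hf x).continuousAt
  have hgc : ∀ i, Continuous (g i) :=
    fun i => continuous_iff_continuousAt.2 fun x => (hg i x).continuousAt
  set K : ℝ := Fintype.card ι * C with hK
  have hKn : ∀ z, ‖coordForm fun i => g i z‖ ≤ K := fun z => norm_coordForm_le fun i => hgC i z
  have hK0 : 0 ≤ K := (norm_nonneg _).trans (hKn 0)
  have hfb : ∀ z, ‖f z‖ ≤ ‖f 0‖ + K * ‖z‖ := by
    intro z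
    have := Convex.norm_image_sub_le_of_norm_hasFDerivWithin_le (f := f) (s := Set.univ)
      (x := 0) (y := z) (fun x _ => (hf x).hasFDerivWithinAt) (fun x _ => hKn x) convex_univ
      (Set.mem_univ _) (Set.mem_univ _)
    rw [sub_zero] at this
    linarith [norm_sub_norm_le (f z) (f 0)]
  set ρ := μ.prod ν with hρ
  have nint : Integrable (fun p : (ι → ℝ) × (ι → ℝ) => ‖p.1‖ + ‖p.2‖) ρ :=
    ((IsGaussian.integrable_id (μ := μ)).norm.comp_fst ν).add
      ((IsGaussian.integrable_id (μ := ν)).norm.comp_snd μ)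
  let Z : ℝ → (ι → ℝ) × (ι → ℝ) → ι → ℝ := fun θ p => Real.cos θ • p.1 + Real.sin θ • p.2
  let Z' : ℝ → (ι → ℝ) × (ι → ℝ) → ι → ℝ := fun θ p => (-Real.sin θ) • p.1 + Real.cos θ • p.2
  have hZn : ∀ θ p, ‖Z θ p‖ ≤ ‖p.1‖ + ‖p.2‖ := by
    intro θ p
    refine (norm_add_le _ _).trans ?_
    rw [norm_smul, norm_smul]
    exact add_le_add (mul_le_of_le_one_left (norm_nonneg _) (Real.abs_cos_le_one θ))
      (mul_le_of_le_one_left (norm_nonneg _) (Real.abs_sin_le_one θ))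
  have hZn' : ∀ θ p, ‖Z' θ p‖ ≤ ‖p.1‖ + ‖p.2‖ := by
    intro θ p
    refine (norm_add_le _ _).trans ?_
    rw [norm_smul, norm_smul, norm_neg]
    exact add_le_add (mul_le_of_le_one_left (norm_nonneg _) (Real.abs_sin_le_one θ))
      (mul_le_of_le_one_left (norm_nonneg _) (Real.abs_cos_le_one θ))
  have hZc : ∀ θ, Continuous (Z θ) := fun θ => by fun_prop
  have hZc' : ∀ θ, Continuous (Z' θ) := fun θ => by fun_prop
  have hderiv : ∀ θ, HasDerivAt (fun θ => ∫ p, f (Z θ p) ∂ρ)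
      (∫ p, (∑ i, g i (Z θ p) * Z' θ p i) ∂ρ) θ := by
    intro θ
    refine (hasDerivAt_integral_of_dominated_loc_of_deriv_le (s := Set.univ)
      (F' := fun θ p => ∑ i, g i (Z θ p) * Z' θ p i)
      (bound := fun p => K * (‖p.1‖ + ‖p.2‖)) Filter.univ_mem
      (Filter.Eventually.of_forall fun t => (hfc.comp (hZc t)).aestronglyMeasurable)
      ?_ ?_ ?_ (nint.const_mul K) ?_).2
    · refine Integrable.mono' ((integrable_const ‖f 0‖).add (nint.const_mul K))
        (hfc.comp (hZc θ)).aestronglyMeasurable (ae_of_all _ fun p => (hfb _).trans ?_)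
      simp only [Pi.add_apply]
      gcongr
      exact hZn θ p
    · refine Continuous.aestronglyMeasurable ?_
      exact continuous_finsetSum _ fun i _ => ((hgc i).comp (hZc θ)).mul
        ((continuous_apply i).comp (hZc' θ))
    · refine ae_of_all _ fun p t _ => ?_
      rw [← coordForm_apply]
      refine (ContinuousLinearMap.le_opNorm _ _).trans ?_
      gcongr
      · exact hKn _
      · exact hZn' t p
    · refine ae_of_all _ fun p t _ => ?_
      rw [← coordForm_apply]
      have h1 : HasDerivAt (fun t => Z t p) (Z' t p) t :=
        ((Real.hasDerivAt_cos t).smul_const p.1).add ((Real.hasDerivAt_sin t).smul_const p.2)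
      exact (hf _).comp_hasDerivAt t h1
  have hnonneg : ∀ θ ∈ Set.Icc 0 (Real.pi / 2),
      0 ≤ ∫ p, (∑ i, g i (Z θ p) * Z' θ p i) ∂ρ := by
    intro θ hθ
    have hs : 0 ≤ Real.sin θ * Real.cos θ := mul_nonneg
      (Real.sin_nonneg_of_nonneg_of_le_pi hθ.1 (by linarith [hθ.2, Real.pi_pos]))
      (Real.cos_nonneg_of_neg_pi_div_two_le_of_le (by linarith [hθ.1, Real.pi_pos]) hθ.2)
    set D : ι → ι → ℝ := fun i j => ∫ x, x i * x j ∂ν - ∫ x, x i * x j ∂μ with hD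
    have hterm : ∀ i, ∫ p, g i (Z θ p) * Z' θ p i ∂ρ
        = ∫ p, (∑ j, H i j (Z θ p) * (Real.sin θ * Real.cos θ * D i j)) ∂ρ := by
      intro i
      have hG : HasGaussianLaw (fun p => (Z' θ p i, Z θ p)) ρ := by
        have := (IsGaussian.hasGaussianLaw_id (μ := ρ)).map_fun (ContinuousLinearMap.prod
          ((ContinuousLinearMap.proj (R := ℝ) (φ := fun _ : ι => ℝ) i).comp
            ((-Real.sin θ) • ContinuousLinearMap.fst ℝ (ι → ℝ) (ι → ℝ)
              + Real.cos θ • ContinuousLinearMap.snd ℝ (ι → ℝ) (ι → ℝ)))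
          (Real.cos θ • ContinuousLinearMap.fst ℝ (ι → ℝ) (ι → ℝ)
              + Real.sin θ • ContinuousLinearMap.snd ℝ (ι → ℝ) (ι → ℝ)))
        exact this
      have hmean : ∫ p, Z' θ p i ∂ρ = 0 := by
        have i1 : Integrable (fun x : ι → ℝ => x i) μ := IsGaussian.integrable_dual μ
          (ContinuousLinearMap.proj (R := ℝ) (φ := fun _ : ι => ℝ) i)
        have i2 : Integrable (fun x : ι → ℝ => x i) ν := IsGaussian.integrable_dual ν
          (ContinuousLinearMap.proj (R := ℝ) (φ := fun _ : ι => ℝ) i)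
        simp only [Z', Pi.add_apply, Pi.smul_apply, smul_eq_mul]
        rw [integral_add ((i1.comp_fst ν).const_mul _) ((i2.comp_snd μ).const_mul _),
          integral_const_mul, integral_const_mul, integral_fun_fst (fun x : ι → ℝ => x i),
          integral_fun_snd (fun x : ι → ℝ => x i), hμ, hν]
        simp
      have := integral_mul_comp_eq_of_hasGaussianLaw hG hmean (C := max C K) (hg i)
        (continuous_coordForm (hHc i)) (fun z => (hgC i z).trans (le_max_left _ _))
        (fun z => (norm_coordForm_le fun j => hHC i j z).trans (le_max_right _ _))
      simp_rw [mul_comm (g i _)]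
      rw [this]
      congr 1
      ext p
      rw [coordForm_apply]
      refine Finset.sum_congr rfl fun j _ => ?_
      rw [hD, ← covariance_rotation hμ hν]
      rfl
    have hZi : ∀ i, Integrable (fun p => g i (Z θ p) * Z' θ p i) ρ := by
      intro i
      refine Integrable.mono' (nint.const_mul C) (((hgc i).comp (hZc θ)).mul
        ((continuous_apply i).comp (hZc' θ))).aestronglyMeasurable (ae_of_all _ fun p => ?_)
      rw [norm_mul]
      exact mul_le_mul (hgC i _) ((norm_le_pi_norm _ i).trans (hZn' θ p)) (norm_nonneg _)
        ((abs_nonneg _).trans (hgC i 0))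
    have hHi : ∀ i, Integrable
        (fun p => ∑ j, H i j (Z θ p) * (Real.sin θ * Real.cos θ * D i j)) ρ := by
      intro i
      refine integrable_finsetSum _ fun j _ => Integrable.mul_const ?_ _
      exact Integrable.of_bound ((hHc i j).comp (hZc θ)).aestronglyMeasurable C
        (ae_of_all _ fun p => hHC i j _)
    rw [integral_finsetSum _ fun i _ => hZi i, Finset.sum_congr rfl fun i _ => hterm i,
      ← integral_finsetSum _ fun i _ => hHi i]
    refine integral_nonneg fun p => ?_
    refine sum_mul_nonneg_of_sum_eq_zero (H := fun i j => H i j (Z θ p))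
      (D := fun i j => Real.sin θ * Real.cos θ * D i j) (fun i j => hsymm i j _)
      (fun i => hsum i _) (fun i j hij => hneg i j hij _) fun i j => ?_
    have hexp : ∀ (m : Measure (ι → ℝ)) [IsGaussian m], ∫ x, (x i - x j) ^ 2 ∂m
        = ∫ x, x i * x i ∂m + ∫ x, x j * x j ∂m - 2 * ∫ x, x i * x j ∂m := by
      intro m _
      have ml : ∀ k, MemLp (fun x : ι → ℝ => x k) 2 m := fun k => IsGaussian.memLp_dual m
        (ContinuousLinearMap.proj (R := ℝ) (φ := fun _ : ι => ℝ) k) 2 (by simp)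
      have mi : ∀ k l, Integrable (fun x : ι → ℝ => x k * x l) m :=
        fun k l => (ml k).integrable_mul (ml l)
      rw [← integral_const_mul, ← integral_add (mi i i) (mi j j),
        ← integral_sub (f := fun x => x i * x i + x j * x j) ((mi i i).add (mi j j))
          ((mi i j).const_mul 2)]
      congr 1; ext x; ring
    have h1 := hinc i j
    rw [hexp μ, hexp ν] at h1
    have h2 : 0 ≤ D i i + D j j - 2 * D i j := by simp only [hD]; linarith
    nlinarith [mul_nonneg hs h2]
  have hmono : MonotoneOn (fun θ => ∫ p, f (Z θ p) ∂ρ) (Set.Icc 0 (Real.pi / 2)) := by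
    refine monotoneOn_of_deriv_nonneg (convex_Icc _ _)
      (fun θ _ => (hderiv θ).continuousAt.continuousWithinAt)
      (fun θ _ => (hderiv θ).differentiableAt.differentiableWithinAt) fun θ hθ => ?_
    rw [(hderiv θ).deriv]
    exact hnonneg θ (interior_subset hθ)
  have h := hmono (Set.left_mem_Icc.2 (by positivity)) (Set.right_mem_Icc.2 (by positivity))
    (by positivity)
  simp only [Z, Real.cos_zero, Real.sin_zero, one_smul, zero_smul, add_zero, zero_add,
    Real.cos_pi_div_two, Real.sin_pi_div_two, hρ] at h
  rw [integral_fun_fst f, integral_fun_snd f] at h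
  simpa using h

end Interpolation

section LogSumExp

variable {ι : Type*} [Fintype ι]

/-- `1 + s ∑ i j, exp (z i - z j)`. -/
noncomputable def diffPartition (s : ℝ) (z : ι → ℝ) : ℝ :=
  1 + s * ((∑ i, Real.exp (z i)) * ∑ i, Real.exp (-z i))

/-- The gradient of `log (diffPartition s ·)`. -/
noncomputable def diffPartitionGrad (s : ℝ) (i : ι) (z : ι → ℝ) : ℝ :=
  s * (Real.exp (z i) * (∑ j, Real.exp (-z j)) - (∑ j, Real.exp (z j)) * Real.exp (-z i)) *
    (diffPartition s z)⁻¹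

open Classical in
/-- The Hessian of `log (diffPartition s ·)`. -/
noncomputable def diffPartitionHess (s : ℝ) (i j : ι) (z : ι → ℝ) : ℝ :=
  (if i = j then
    s * (Real.exp (z i) * (∑ j, Real.exp (-z j)) + (∑ j, Real.exp (z j)) * Real.exp (-z i)) *
      (diffPartition s z)⁻¹ else 0)
  - s * (Real.exp (z i) * Real.exp (-z j) + Real.exp (z j) * Real.exp (-z i)) *
      (diffPartition s z)⁻¹
  - diffPartitionGrad s i z * diffPartitionGrad s j z

theorem sum_exp_nonneg (z : ι → ℝ) : 0 ≤ ∑ i, Real.exp (z i) :=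
  Finset.sum_nonneg fun _ _ => (Real.exp_pos _).le

theorem sum_exp_neg_nonneg (z : ι → ℝ) : 0 ≤ ∑ i, Real.exp (-z i) :=
  Finset.sum_nonneg fun _ _ => (Real.exp_pos _).le

theorem exp_le_sum_exp (z : ι → ℝ) (i : ι) : Real.exp (z i) ≤ ∑ i, Real.exp (z i) :=
  Finset.single_le_sum (f := fun i => Real.exp (z i)) (fun _ _ => (Real.exp_pos _).le)
    (Finset.mem_univ i)

theorem exp_neg_le_sum_exp_neg (z : ι → ℝ) (i : ι) : Real.exp (-z i) ≤ ∑ i, Real.exp (-z i) :=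
  exp_le_sum_exp (fun i => -z i) i

theorem one_le_diffPartition {s : ℝ} (hs : 0 ≤ s) (z : ι → ℝ) : 1 ≤ diffPartition s z :=
  le_add_of_nonneg_right (mul_nonneg hs (mul_nonneg (sum_exp_nonneg z) (sum_exp_neg_nonneg z)))

theorem diffPartition_pos {s : ℝ} (hs : 0 ≤ s) (z : ι → ℝ) : 0 < diffPartition s z :=
  zero_lt_one.trans_le (one_le_diffPartition hs z)

theorem hasFDerivAt_sum_exp (z : ι → ℝ) :
    HasFDerivAt (fun z : ι → ℝ => ∑ i, Real.exp (z i)) (coordForm fun i => Real.exp (z i)) z :=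
  HasFDerivAt.fun_sum fun i _ => (hasFDerivAt_apply (𝕜 := ℝ) (F' := fun _ : ι => ℝ) i z).exp

theorem hasFDerivAt_sum_exp_neg (z : ι → ℝ) :
    HasFDerivAt (fun z : ι → ℝ => ∑ i, Real.exp (-z i))
      (coordForm fun i => -Real.exp (-z i)) z := by
  refine (HasFDerivAt.fun_sum fun i _ =>
    (hasFDerivAt_apply (𝕜 := ℝ) (F' := fun _ : ι => ℝ) i z).fun_neg.exp).congr_fderiv ?_
  ext v
  simp

theorem hasFDerivAt_diffPartition {s : ℝ} (hs : 0 ≤ s) (z : ι → ℝ) :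
    HasFDerivAt (diffPartition s)
      (diffPartition s z • coordForm fun i => diffPartitionGrad s i z) z := by
  refine (((hasFDerivAt_sum_exp z).mul (hasFDerivAt_sum_exp_neg z)).const_mul s).const_add 1
    |>.congr_fderiv ?_
  have hW := (diffPartition_pos hs z).ne'
  ext v
  simp only [_root_.smul_apply, _root_.add_apply, coordForm_apply,
    smul_eq_mul, Finset.mul_sum, ← Finset.sum_add_distrib, diffPartitionGrad]
  refine Finset.sum_congr rfl fun i _ => ?_
  simp only [← Finset.mul_sum]
  field_simp
  ring

theorem hasFDerivAt_log_diffPartition {s : ℝ} (hs : 0 ≤ s) (z : ι → ℝ) :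
    HasFDerivAt (fun z => Real.log (diffPartition s z))
      (coordForm fun i => diffPartitionGrad s i z) z := by
  have hW := (diffPartition_pos hs z).ne'
  refine ((hasFDerivAt_diffPartition hs z).log hW).congr_fderiv ?_
  rw [smul_smul, inv_mul_cancel₀ hW, one_smul]

theorem hasFDerivAt_diffPartitionGrad {s : ℝ} (hs : 0 ≤ s) (i : ι) (z : ι → ℝ) :
    HasFDerivAt (diffPartitionGrad s i) (coordForm fun j => diffPartitionHess s i j z) z := by
  classical
  have hW := (diffPartition_pos hs z).ne'
  have hp := hasFDerivAt_apply (𝕜 := ℝ) (F' := fun _ : ι => ℝ) i z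
  have hN := (((hp.exp).mul (hasFDerivAt_sum_exp_neg z)).sub
    ((hasFDerivAt_sum_exp z).mul hp.fun_neg.exp)).const_mul s
  have hI := (hasFDerivAt_inv hW).comp z (hasFDerivAt_diffPartition hs z)
  refine (hN.mul hI).congr_fderiv ?_
  ext v
  have e : ∑ j, diffPartitionHess s i j z * v j
      = s * (Real.exp (z i) * (∑ j, Real.exp (-z j)) + (∑ j, Real.exp (z j)) * Real.exp (-z i)) *
          (diffPartition s z)⁻¹ * v i
        - s * (Real.exp (z i) * (∑ j, Real.exp (-z j) * v j)
          + (∑ j, Real.exp (z j) * v j) * Real.exp (-z i)) * (diffPartition s z)⁻¹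
        - diffPartitionGrad s i z * ∑ j, diffPartitionGrad s j z * v j := by
    simp only [diffPartitionHess, sub_mul, Finset.sum_sub_distrib, ite_mul, zero_mul,
      Finset.sum_ite_eq, Finset.mem_univ, if_true]
    congr 1
    · congr 1
      rw [Finset.mul_sum, Finset.sum_mul, ← Finset.sum_add_distrib, Finset.mul_sum, Finset.sum_mul]
      exact Finset.sum_congr rfl fun j _ => by ring
    · rw [Finset.mul_sum]
      exact Finset.sum_congr rfl fun j _ => by ring
  simp only [coordForm_apply, e]
  simp only [_root_.smul_apply, _root_.add_apply, coordForm_apply,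
    _root_.sub_apply, ContinuousLinearMap.comp_apply, _root_.neg_apply,
    smul_eq_mul, ContinuousLinearMap.proj_apply, ContinuousLinearMap.toSpanSingleton_apply,
    neg_mul, Finset.sum_neg_distrib, Function.comp]
  generalize ∑ j, diffPartitionGrad s j z * v j = G
  simp only [diffPartitionGrad, Pi.mul_apply, Pi.sub_apply]
  field_simp
  ring

theorem inv_diffPartition_mul_le {s t : ℝ} (hs : 0 ≤ s) (z : ι → ℝ)
    (ht : t ≤ (∑ i, Real.exp (z i)) * ∑ i, Real.exp (-z i)) :
    s * t * (diffPartition s z)⁻¹ ≤ 1 := by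
  rw [← div_eq_mul_inv, div_le_one (diffPartition_pos hs z), diffPartition]
  nlinarith [mul_le_mul_of_nonneg_left ht hs]

theorem abs_diffPartitionGrad_le {s : ℝ} (hs : 0 ≤ s) (i : ι) (z : ι → ℝ) :
    |diffPartitionGrad s i z| ≤ 1 := by
  have h1 := mul_le_mul_of_nonneg_right (exp_le_sum_exp z i) (sum_exp_neg_nonneg z)
  have h2 := mul_le_mul_of_nonneg_left (exp_neg_le_sum_exp_neg z i) (sum_exp_nonneg z)
  have h3 := mul_nonneg (Real.exp_pos (z i)).le (sum_exp_neg_nonneg z)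
  have h4 := mul_nonneg (sum_exp_nonneg z) (Real.exp_pos (-z i)).le
  rw [abs_le', diffPartitionGrad]
  refine ⟨inv_diffPartition_mul_le hs z (by linarith), ?_⟩
  rw [← neg_mul, ← mul_neg]
  exact inv_diffPartition_mul_le hs z (by linarith)

theorem exp_mul_exp_neg_le (z : ι → ℝ) (i j : ι) :
    Real.exp (z i) * Real.exp (-z j) ≤ (∑ i, Real.exp (z i)) * ∑ i, Real.exp (-z i) :=
  mul_le_mul (exp_le_sum_exp z i) (exp_neg_le_sum_exp_neg z j) (Real.exp_pos _).le
    (sum_exp_nonneg z)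

theorem abs_diffPartitionHess_le {s : ℝ} (hs : 0 ≤ s) (i j : ι) (z : ι → ℝ) :
    |diffPartitionHess s i j z| ≤ 5 := by
  have hW := inv_nonneg.2 (diffPartition_pos hs z).le
  have h1 := mul_le_mul_of_nonneg_right (exp_le_sum_exp z i) (sum_exp_neg_nonneg z)
  have h2 := mul_le_mul_of_nonneg_left (exp_neg_le_sum_exp_neg z i) (sum_exp_nonneg z)
  have h3 := mul_nonneg (Real.exp_pos (z i)).le (sum_exp_neg_nonneg z)
  have h4 := mul_nonneg (sum_exp_nonneg z) (Real.exp_pos (-z i)).le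
  have a1 := inv_diffPartition_mul_le hs z h1
  have a2 := inv_diffPartition_mul_le hs z h2
  have a3 := inv_diffPartition_mul_le hs z (exp_mul_exp_neg_le z i j)
  have a4 := inv_diffPartition_mul_le hs z (exp_mul_exp_neg_le z j i)
  have b1 := mul_nonneg (mul_nonneg hs h3) hW
  have b2 := mul_nonneg (mul_nonneg hs h4) hW
  have b3 := mul_nonneg (mul_nonneg hs
    (mul_nonneg (Real.exp_pos (z i)).le (Real.exp_pos (-z j)).le)) hW
  have b4 := mul_nonneg (mul_nonneg hs
    (mul_nonneg (Real.exp_pos (z j)).le (Real.exp_pos (-z i)).le)) hW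
  have hg : |diffPartitionGrad s i z * diffPartitionGrad s j z| ≤ 1 := by
    rw [abs_mul]
    exact mul_le_one₀ (abs_diffPartitionGrad_le hs i z) (abs_nonneg _)
      (abs_diffPartitionGrad_le hs j z)
  rw [abs_le] at hg ⊢
  unfold diffPartitionHess
  rw [mul_add, add_mul, mul_add, add_mul]
  split_ifs <;> constructor <;> linarith

theorem continuous_diffPartitionHess {s : ℝ} (hs : 0 ≤ s) (i j : ι) :
    Continuous (diffPartitionHess s i j) := by
  have h1 : Continuous fun z : ι → ℝ => (diffPartition s z)⁻¹ :=
    Continuous.inv₀ (by unfold diffPartition; fun_prop) fun z => (diffPartition_pos hs z).ne'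
  unfold diffPartitionHess diffPartitionGrad
  split_ifs <;> fun_prop

theorem diffPartitionHess_symm (s : ℝ) (i j : ι) (z : ι → ℝ) :
    diffPartitionHess s i j z = diffPartitionHess s j i z := by
  by_cases h : i = j
  · rw [h]
  · simp only [diffPartitionHess, if_neg h, if_neg (Ne.symm h)]
    ring

theorem sum_diffPartitionGrad (s : ℝ) (z : ι → ℝ) : ∑ i, diffPartitionGrad s i z = 0 := by
  simp only [diffPartitionGrad, ← Finset.sum_mul, ← Finset.mul_sum, Finset.sum_sub_distrib]
  simp

theorem sum_diffPartitionHess (s : ℝ) (i : ι) (z : ι → ℝ) :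
    ∑ j, diffPartitionHess s i j z = 0 := by
  classical
  simp only [diffPartitionHess, Finset.sum_sub_distrib, Finset.sum_ite_eq, Finset.mem_univ,
    if_true]
  simp only [← Finset.mul_sum, sum_diffPartitionGrad, ← Finset.sum_mul, Finset.sum_add_distrib]
  ring

theorem diffPartitionHess_nonpos {s : ℝ} (hs : 0 ≤ s) {i j : ι} (hij : i ≠ j) (z : ι → ℝ) :
    diffPartitionHess s i j z ≤ 0 := by
  have hW := diffPartition_pos hs z
  simp only [diffPartitionHess, if_neg hij, diffPartitionGrad]
  set A := ∑ i, Real.exp (z i)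
  set B := ∑ i, Real.exp (-z i)
  set W := diffPartition s z with hWd
  have hWAB : W = 1 + s * (A * B) := rfl
  have hA : 0 ≤ A := sum_exp_nonneg z
  have hB : 0 ≤ B := sum_exp_neg_nonneg z
  have p1 := Real.exp_pos (z i)
  have p2 := Real.exp_pos (z j)
  have p3 := Real.exp_pos (-z i)
  have p4 := Real.exp_pos (-z j)
  set a := Real.exp (z i)
  set b := Real.exp (z j)
  set a' := Real.exp (-z i)
  set b' := Real.exp (-z j)
  have key : 0 - s * (a * b' + b * a') * W⁻¹
      - s * (a * B - A * a') * W⁻¹ * (s * (b * B - A * b') * W⁻¹)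
      = -(s * (a * b' + b * a') + s ^ 2 * (a * b * B ^ 2 + A ^ 2 * a' * b')) * W⁻¹ ^ 2 := by
    field_simp
    rw [hWAB]
    ring
  rw [key]
  have : 0 ≤ s * (a * b' + b * a') + s ^ 2 * (a * b * B ^ 2 + A ^ 2 * a' * b') := by positivity
  exact mul_nonpos_of_nonpos_of_nonneg (neg_nonpos.2 this) (by positivity)

/-- Comparison of `log (1 + s ∑ i j, exp (x i - x j))` under two Gaussian laws. -/
theorem integral_log_diffPartition_le {μ ν : Measure (ι → ℝ)} [IsGaussian μ] [IsGaussian ν]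
    (hμ : ∀ i, ∫ x, x i ∂μ = 0) (hν : ∀ i, ∫ x, x i ∂ν = 0)
    (hinc : ∀ i j, ∫ x, (x i - x j) ^ 2 ∂μ ≤ ∫ x, (x i - x j) ^ 2 ∂ν) {s : ℝ} (hs : 0 ≤ s) :
    ∫ x, Real.log (diffPartition s x) ∂μ ≤ ∫ x, Real.log (diffPartition s x) ∂ν :=
  integral_le_integral_of_increments_le hμ hν hinc (C := 5) (hasFDerivAt_log_diffPartition hs)
    (hasFDerivAt_diffPartitionGrad hs) (continuous_diffPartitionHess hs)
    (fun i z => (abs_diffPartitionGrad_le hs i z).trans (by norm_num))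
    (abs_diffPartitionHess_le hs) (diffPartitionHess_symm s) (sum_diffPartitionHess s)
    fun _ _ hij z => diffPartitionHess_nonpos hs hij z

end LogSumExp

section CoordRange

variable {ι : Type*} [Fintype ι] [Nonempty ι]

/-- The range `max i j, (x i - x j)` of a vector. -/
noncomputable def coordRange (x : ι → ℝ) : ℝ :=
  Finset.univ.sup' Finset.univ_nonempty fun p : ι × ι => x p.1 - x p.2

theorem sub_le_coordRange (x : ι → ℝ) (i j : ι) : x i - x j ≤ coordRange x :=
  Finset.le_sup' (fun p : ι × ι => x p.1 - x p.2) (Finset.mem_univ (i, j))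

theorem exists_coordRange_eq (x : ι → ℝ) : ∃ i j, coordRange x = x i - x j := by
  obtain ⟨p, -, hp⟩ := Finset.exists_mem_eq_sup' (Finset.univ_nonempty (α := ι × ι))
    fun p : ι × ι => x p.1 - x p.2
  exact ⟨p.1, p.2, hp⟩

theorem coordRange_nonneg (x : ι → ℝ) : 0 ≤ coordRange x := by
  simpa using sub_le_coordRange x (Classical.arbitrary ι) (Classical.arbitrary ι)

theorem coordRange_le (x : ι → ℝ) : coordRange x ≤ 2 * ‖x‖ := by
  obtain ⟨i, j, h⟩ := exists_coordRange_eq x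
  have h1 := (abs_le.1 (norm_le_pi_norm x i)).2
  have h2 := (abs_le.1 (norm_le_pi_norm x j)).1
  linarith

@[fun_prop]
theorem continuous_coordRange : Continuous (coordRange : (ι → ℝ) → ℝ) :=
  Continuous.finset_sup'_apply _ fun p _ => by fun_prop

theorem diffPartition_smul_ge {s β : ℝ} (hs : 0 ≤ s) (x : ι → ℝ) :
    1 + s * Real.exp (β * coordRange x) ≤ diffPartition s (β • x) := by
  obtain ⟨i, j, h⟩ := exists_coordRange_eq x
  unfold diffPartition
  refine (add_le_add_iff_left 1).2 (mul_le_mul_of_nonneg_left ?_ hs)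
  refine le_trans (le_of_eq ?_) (exp_mul_exp_neg_le (β • x) i j)
  rw [h, ← Real.exp_add]
  congr 1
  simp only [Pi.smul_apply, smul_eq_mul]
  ring

theorem diffPartition_smul_le {s β : ℝ} (hs : 0 ≤ s) (hβ : 0 ≤ β) (x : ι → ℝ) :
    diffPartition s (β • x) ≤ 1 + s * (Fintype.card ι ^ 2 * Real.exp (β * coordRange x)) := by
  have : ∀ i j, Real.exp ((β • x) i) * Real.exp (-(β • x) j)
      ≤ Real.exp (β * coordRange x) := by
    intro i j
    rw [← Real.exp_add, Real.exp_le_exp]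
    have := mul_le_mul_of_nonneg_left (sub_le_coordRange x i j) hβ
    simp only [Pi.smul_apply, smul_eq_mul]
    linarith
  have hle : (∑ i, Real.exp ((β • x) i)) * ∑ i, Real.exp (-(β • x) i)
      ≤ Fintype.card ι ^ 2 * Real.exp (β * coordRange x) := by
    rw [Finset.sum_mul_sum]
    calc _ ≤ ∑ _i : ι, ∑ _j : ι, Real.exp (β * coordRange x) :=
          Finset.sum_le_sum fun i _ => Finset.sum_le_sum fun j _ => this i j
      _ = _ := by simp; ring
  unfold diffPartition
  linarith [mul_le_mul_of_nonneg_left hle hs]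

theorem max_sub_le_log_diffPartition {β : ℝ} (hβ : 0 < β) (a : ℝ) (x : ι → ℝ) :
    max (coordRange x - a) 0
      ≤ β⁻¹ * Real.log (diffPartition (Real.exp (-(β * a))) (β • x)) := by
  have h := diffPartition_smul_ge (β := β) (Real.exp_pos (-(β * a))).le x
  rw [← Real.exp_add] at h
  rw [← div_eq_inv_mul, le_div_iff₀ hβ, max_mul_of_nonneg _ _ hβ.le, zero_mul]
  refine max_le ?_ (Real.log_nonneg (one_le_diffPartition (Real.exp_pos _).le _))
  rw [Real.le_log_iff_exp_le (diffPartition_pos (Real.exp_pos _).le _)]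
  refine le_trans (le_trans (Real.exp_le_exp.2 (le_of_eq ?_)) (le_add_of_nonneg_left zero_le_one)) h
  ring

theorem log_diffPartition_le {β : ℝ} (hβ : 0 < β) (a : ℝ) (x : ι → ℝ) :
    β⁻¹ * Real.log (diffPartition (Real.exp (-(β * a))) (β • x))
      ≤ max (coordRange x - a) 0 + β⁻¹ * Real.log (1 + Fintype.card ι ^ 2) := by
  set m := max (coordRange x - a) 0 with hm
  have hm0 : 0 ≤ m := le_max_right _ _
  have h1 : diffPartition (Real.exp (-(β * a))) (β • x)
      ≤ (1 + Fintype.card ι ^ 2) * Real.exp (β * m) := by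
    refine (diffPartition_smul_le (Real.exp_pos _).le hβ.le x).trans ?_
    have e1 : (1 : ℝ) ≤ Real.exp (β * m) := Real.one_le_exp (by positivity)
    have e2 : Real.exp (-(β * a)) * Real.exp (β * coordRange x) ≤ Real.exp (β * m) := by
      rw [← Real.exp_add, Real.exp_le_exp]
      have := mul_le_mul_of_nonneg_left (le_max_left (coordRange x - a) 0) hβ.le
      rw [← hm] at this
      linarith
    have e3 := mul_le_mul_of_nonneg_left e2 (sq_nonneg (Fintype.card ι : ℝ))
    linarith
  have h2 := Real.log_le_log (diffPartition_pos (Real.exp_pos _).le _) h1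
  rw [Real.log_mul (by positivity) (Real.exp_pos _).ne', Real.log_exp] at h2
  calc _ ≤ β⁻¹ * (Real.log (1 + Fintype.card ι ^ 2) + β * m) := by gcongr
    _ = _ := by field_simp; ring

variable {μ ν : Measure (ι → ℝ)} [IsGaussian μ] [IsGaussian ν]

theorem integrable_max_coordRange_sub (a : ℝ) :
    Integrable (fun x => max (coordRange x - a) 0) μ := by
  have h : Integrable coordRange μ := by
    refine Integrable.mono' ((IsGaussian.integrable_id (μ := μ)).norm.const_mul 2)
      (by fun_prop) (ae_of_all _ fun x => ?_)
    rw [Real.norm_of_nonneg (coordRange_nonneg x)]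
    exact coordRange_le x
  exact (h.sub (integrable_const a)).pos_part

theorem integral_max_coordRange_sub_le
    (hμ : ∀ i, ∫ x, x i ∂μ = 0) (hν : ∀ i, ∫ x, x i ∂ν = 0)
    (hinc : ∀ i j, ∫ x, (x i - x j) ^ 2 ∂μ ≤ ∫ x, (x i - x j) ^ 2 ∂ν) (a : ℝ) :
    ∫ x, max (coordRange x - a) 0 ∂μ ≤ ∫ x, max (coordRange x - a) 0 ∂ν := by
  set K := Real.log (1 + (Fintype.card ι : ℝ) ^ 2)
  have key : ∀ β : ℝ, 0 < β →
      ∫ x, max (coordRange x - a) 0 ∂μ ≤ ∫ x, max (coordRange x - a) 0 ∂ν + β⁻¹ * K := by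
    intro β hβ
    let L : (ι → ℝ) →L[ℝ] (ι → ℝ) := β • ContinuousLinearMap.id ℝ (ι → ℝ)
    set s := Real.exp (-(β * a))
    have hs : 0 ≤ s := (Real.exp_pos _).le
    have hlc : Continuous fun x : ι → ℝ => Real.log (diffPartition s x) :=
      continuous_iff_continuousAt.2 fun x => (hasFDerivAt_log_diffPartition hs x).continuousAt
    have hmap : ∀ (m : Measure (ι → ℝ)), ∀ {F : (ι → ℝ) → ℝ}, Continuous F →
        ∫ x, F x ∂(m.map L) = ∫ x, F (β • x) ∂m := fun m F hF =>
      integral_map (by fun_prop) hF.aestronglyMeasurable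
    have hcen : ∀ (m : Measure (ι → ℝ)), (∀ i, ∫ x, x i ∂m = 0) →
        ∀ i, ∫ x, x i ∂(m.map L) = 0 := fun m hm i => by
      rw [hmap m (F := fun x => x i) (by fun_prop)]
      simp [integral_const_mul, hm]
    have hsq : ∀ (m : Measure (ι → ℝ)) i j, ∫ x, (x i - x j) ^ 2 ∂(m.map L)
        = β ^ 2 * ∫ x, (x i - x j) ^ 2 ∂m := fun m i j => by
      rw [hmap m (F := fun x => (x i - x j) ^ 2) (by fun_prop), ← integral_const_mul]
      congr 1; ext x
      simp only [Pi.smul_apply, smul_eq_mul]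
      ring
    have hmain := integral_log_diffPartition_le (μ := μ.map L) (ν := ν.map L)
      (hcen μ hμ) (hcen ν hν) (fun i j => by
        rw [hsq, hsq]
        exact mul_le_mul_of_nonneg_left (hinc i j) (sq_nonneg β)) hs
    rw [hmap μ hlc, hmap ν hlc] at hmain
    have hint : ∀ (m : Measure (ι → ℝ)) [IsGaussian m],
        Integrable (fun x => β⁻¹ * Real.log (diffPartition s (β • x))) m := fun m _ => by
      refine Integrable.mono' ((integrable_max_coordRange_sub a).add (integrable_const (β⁻¹ * K)))
        ((hlc.comp (continuous_const_smul β)).const_smul β⁻¹).aestronglyMeasurable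
        (ae_of_all _ fun x => ?_)
      rw [Real.norm_of_nonneg ((le_max_right _ _).trans (max_sub_le_log_diffPartition hβ a x))]
      exact log_diffPartition_le hβ a x
    calc ∫ x, max (coordRange x - a) 0 ∂μ
        ≤ ∫ x, β⁻¹ * Real.log (diffPartition s (β • x)) ∂μ :=
          integral_mono (integrable_max_coordRange_sub a) (hint μ)
            fun x => max_sub_le_log_diffPartition hβ a x
      _ ≤ ∫ x, β⁻¹ * Real.log (diffPartition s (β • x)) ∂ν := by
          rw [integral_const_mul, integral_const_mul]
          exact mul_le_mul_of_nonneg_left hmain (inv_nonneg.2 hβ.le)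
      _ ≤ ∫ x, (max (coordRange x - a) 0 + β⁻¹ * K) ∂ν :=
          integral_mono (hint ν) ((integrable_max_coordRange_sub a).add (integrable_const _))
            fun x => log_diffPartition_le hβ a x
      _ = _ := by
          rw [integral_add (integrable_max_coordRange_sub a) (integrable_const _)]
          simp
  refine ge_of_tendsto (f := fun β : ℝ => ∫ x, max (coordRange x - a) 0 ∂ν + β⁻¹ * K)
    (x := Filter.atTop) ?_ (Filter.eventually_atTop.2 ⟨1, fun β hβ => key β (by linarith)⟩)
  simpa using (tendsto_inv_atTop_zero.mul_const K).const_add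
    (∫ x, max (coordRange x - a) 0 ∂ν)

end CoordRange

/-- A power as a mixture of the hinge functions `t ↦ max (t - a) 0`. -/
theorem lintegral_hinge_mul_rpow {q : ℝ} (hq : 1 < q) {t : ℝ} (ht : 0 ≤ t) :
    ∫⁻ a in Set.Ioi (0 : ℝ), ENNReal.ofReal (max (t - a) 0) * ENNReal.ofReal (a ^ (q - 2))
      = ENNReal.ofReal ((q * (q - 1))⁻¹ * t ^ q) := by
  have h1 : ∫⁻ a in Set.Ioi (0 : ℝ), ENNReal.ofReal (max (t - a) 0) * ENNReal.ofReal (a ^ (q - 2))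
      = ∫⁻ a in Set.Ioc 0 t, ENNReal.ofReal (t * a ^ (q - 2) - a ^ (q - 1)) := by
    rw [← Set.Ioc_union_Ioi_eq_Ioi ht,
      lintegral_union measurableSet_Ioi (Set.Ioc_disjoint_Ioi le_rfl)]
    have hz : ∫⁻ a in Set.Ioi t, ENNReal.ofReal (max (t - a) 0) * ENNReal.ofReal (a ^ (q - 2))
        = 0 := by
      rw [setLIntegral_congr_fun (g := fun _ => 0) measurableSet_Ioi]
      · simp
      · intro a ha
        have : max (t - a) 0 = 0 := max_eq_right (sub_nonpos.2 (le_of_lt ha))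
        simp [this]
    rw [hz, add_zero]
    refine setLIntegral_congr_fun measurableSet_Ioc fun a ha => ?_
    have h0 : 0 ≤ t - a := sub_nonneg.2 ha.2
    rw [max_eq_left h0, ← ENNReal.ofReal_mul h0, sub_mul]
    congr 2
    rw [show q - 1 = 1 + (q - 2) by ring, Real.rpow_add ha.1, Real.rpow_one]
  have i1 : IntervalIntegrable (fun a : ℝ => t * a ^ (q - 2)) volume 0 t :=
    (intervalIntegral.intervalIntegrable_rpow' (by linarith)).const_mul t
  have i2 : IntervalIntegrable (fun a : ℝ => a ^ (q - 1)) volume 0 t :=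
    intervalIntegral.intervalIntegrable_rpow' (by linarith)
  rw [h1, ← ofReal_integral_eq_lintegral_ofReal]
  · rw [← intervalIntegral.integral_of_le ht, intervalIntegral.integral_sub i1 i2,
      intervalIntegral.integral_const_mul, integral_rpow (Or.inl (by linarith)),
      integral_rpow (Or.inl (by linarith)), Real.zero_rpow (by linarith),
      Real.zero_rpow (by linarith)]
    congr 1
    have hq1 : q - 1 ≠ 0 := by linarith
    have hq0 : q ≠ 0 := by linarith
    rw [show q - 2 + 1 = q - 1 by ring, show q - 1 + 1 = q by ring]
    have ht' : t * t ^ (q - 1) = t ^ q := by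
      rcases ht.eq_or_lt with rfl | h
      · rw [zero_mul, Real.zero_rpow hq0]
      · rw [Real.rpow_sub_one h.ne']; field_simp
    rw [sub_zero, sub_zero, mul_div_assoc', ht']
    field_simp
    ring
  · exact (intervalIntegrable_iff_integrableOn_Ioc_of_le ht).1 (i1.sub i2)
  · refine (ae_restrict_iff' measurableSet_Ioc).2 (ae_of_all _ fun a ha => ?_)
    simp only [Pi.zero_apply]
    rw [show q - 1 = 1 + (q - 2) by ring, Real.rpow_add ha.1, Real.rpow_one, ← sub_mul]
    exact mul_nonneg (sub_nonneg.2 ha.2) (Real.rpow_nonneg ha.1.le _)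

theorem lintegral_rpow_eq_lintegral_hinge {α : Type*} [MeasurableSpace α] {μ : Measure α}
    [SFinite μ] {u : α → ℝ} (hu : Measurable u) (hu0 : ∀ x, 0 ≤ u x) {q : ℝ} (hq : 1 < q) :
    ∫⁻ x, ENNReal.ofReal (u x ^ q) ∂μ
      = ENNReal.ofReal (q * (q - 1)) * ∫⁻ a in Set.Ioi (0 : ℝ),
        (∫⁻ x, ENNReal.ofReal (max (u x - a) 0) ∂μ) * ENNReal.ofReal (a ^ (q - 2)) := by
  have hc : 0 < q * (q - 1) := mul_pos (by linarith) (by linarith)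
  calc ∫⁻ x, ENNReal.ofReal (u x ^ q) ∂μ
      = ∫⁻ x, (ENNReal.ofReal (q * (q - 1)) * ∫⁻ a in Set.Ioi (0 : ℝ),
          ENNReal.ofReal (max (u x - a) 0) * ENNReal.ofReal (a ^ (q - 2))) ∂μ := by
        refine lintegral_congr fun x => ?_
        rw [lintegral_hinge_mul_rpow hq (hu0 x), ← ENNReal.ofReal_mul hc.le, ← mul_assoc,
          mul_inv_cancel₀ hc.ne', one_mul]
    _ = _ := by
        rw [lintegral_const_mul' _ _ ENNReal.ofReal_ne_top, lintegral_lintegral_swap]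
        · congr 1
          refine lintegral_congr fun a => ?_
          rw [lintegral_mul_const' _ _ ENNReal.ofReal_ne_top]
        · refine Measurable.aemeasurable ?_
          fun_prop

/-- Stop-loss domination of nonnegative variables implies domination of all moments of order
at least one. -/
theorem lintegral_rpow_le_of_hinge_le {α β : Type*} [MeasurableSpace α] [MeasurableSpace β]
    {μ : Measure α} {ν : Measure β} [SFinite μ] [SFinite ν] {u : α → ℝ} {v : β → ℝ}
    (hu : Measurable u) (hv : Measurable v) (hu0 : ∀ x, 0 ≤ u x) (hv0 : ∀ x, 0 ≤ v x)
    (h : ∀ a, ∫⁻ x, ENNReal.ofReal (max (u x - a) 0) ∂μ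
      ≤ ∫⁻ x, ENNReal.ofReal (max (v x - a) 0) ∂ν) {q : ℝ} (hq : 1 ≤ q) :
    ∫⁻ x, ENNReal.ofReal (u x ^ q) ∂μ ≤ ∫⁻ x, ENNReal.ofReal (v x ^ q) ∂ν := by
  rcases hq.eq_or_lt with rfl | hq
  · simpa [hu0, hv0] using h 0
  rw [lintegral_rpow_eq_lintegral_hinge hu hu0 hq, lintegral_rpow_eq_lintegral_hinge hv hv0 hq]
  gcongr
  exact h _

/-- Moment comparison of the ranges of two centered Gaussian vectors. -/
theorem lintegral_coordRange_rpow_le {ι : Type*} [Fintype ι] [Nonempty ι]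
    {μ ν : Measure (ι → ℝ)} [IsGaussian μ] [IsGaussian ν]
    (hμ : ∀ i, ∫ x, x i ∂μ = 0) (hν : ∀ i, ∫ x, x i ∂ν = 0)
    (hinc : ∀ i j, ∫ x, (x i - x j) ^ 2 ∂μ ≤ ∫ x, (x i - x j) ^ 2 ∂ν) {q : ℝ} (hq : 1 ≤ q) :
    ∫⁻ x, ENNReal.ofReal (coordRange x ^ q) ∂μ ≤ ∫⁻ x, ENNReal.ofReal (coordRange x ^ q) ∂ν := by
  refine lintegral_rpow_le_of_hinge_le continuous_coordRange.measurable
    continuous_coordRange.measurable coordRange_nonneg coordRange_nonneg (fun a => ?_) hq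
  rw [← ofReal_integral_eq_lintegral_ofReal (integrable_max_coordRange_sub a)
      (ae_of_all _ fun x => le_max_right _ _),
    ← ofReal_integral_eq_lintegral_ofReal (integrable_max_coordRange_sub a)
      (ae_of_all _ fun x => le_max_right _ _)]
  exact ENNReal.ofReal_le_ofReal (integral_max_coordRange_sub_le hμ hν hinc a)

theorem ofReal_abs_le_supAbs {T Ω : Type*} (G : T → Ω → ℝ) (t : T) (ω : Ω) :
    ENNReal.ofReal |G t ω| ≤ supAbs G ω :=
  le_iSup (fun t => ENNReal.ofReal |G t ω|) t

/-- Comparison of the maximum over a finite set of a centered Gaussian process vanishing at a point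
of that set with the supremum of a centered Gaussian process with larger increments. -/
theorem lintegral_biSup_rpow_le {T Ω : Type*} [MeasurableSpace Ω] {P : Measure Ω}
    {X Y : T → Ω → ℝ} (hX : IsCenteredGaussianFamily X P) (hY : IsCenteredGaussianFamily Y P)
    (hinc : ∀ s t, ∫ ω, |X s ω - X t ω| ^ 2 ∂P ≤ ∫ ω, |Y s ω - Y t ω| ^ 2 ∂P)
    {t₀ : T} (h0 : ∀ ω, X t₀ ω = 0) {I : Finset T} (hI : t₀ ∈ I) {q : ℝ} (hq : 1 ≤ q) :
    ∫⁻ ω, (⨆ t ∈ I, ENNReal.ofReal |X t ω|) ^ q ∂P ≤ 2 ^ q * ∫⁻ ω, (supAbs Y ω) ^ q ∂P := by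
  have hq0 : 0 ≤ q := zero_le_one.trans hq
  have : Nonempty I := ⟨⟨t₀, hI⟩⟩
  let V : (T → Ω → ℝ) → Ω → I → ℝ := fun Z ω => I.restrict (Z · ω)
  have hVX : HasGaussianLaw (V X) P := hX.isGaussianProcess.hasGaussianLaw I
  have hVY : HasGaussianLaw (V Y) P := hY.isGaussianProcess.hasGaussianLaw I
  have := hVX.isGaussian_map
  have := hVY.isGaussian_map
  have hcen : ∀ {Z : T → Ω → ℝ}, IsCenteredGaussianFamily Z P → HasGaussianLaw (V Z) P →
      ∀ i : I, ∫ x, x i ∂(P.map (V Z)) = 0 := fun {Z} hZ hV i => by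
    rw [integral_map hV.aemeasurable (continuous_apply i).aestronglyMeasurable]
    exact hZ.integral_eq_zero i
  have hsq : ∀ {Z : T → Ω → ℝ}, HasGaussianLaw (V Z) P → ∀ i j : I,
      ∫ x, (x i - x j) ^ 2 ∂(P.map (V Z)) = ∫ ω, |Z i ω - Z j ω| ^ 2 ∂P := fun {Z} hV i j => by
    rw [integral_map hV.aemeasurable (by fun_prop)]
    simp only [sq_abs]
    rfl
  have hmap : ∀ {Z : T → Ω → ℝ}, HasGaussianLaw (V Z) P →
      ∫⁻ x, ENNReal.ofReal (coordRange x ^ q) ∂(P.map (V Z))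
        = ∫⁻ ω, ENNReal.ofReal (coordRange (V Z ω)) ^ q ∂P := fun {Z} hV => by
    rw [lintegral_map' _ hV.aemeasurable]
    · exact lintegral_congr fun ω =>
        (ENNReal.ofReal_rpow_of_nonneg (coordRange_nonneg _) hq0).symm
    · refine Measurable.aemeasurable ?_
      exact (continuous_coordRange.measurable.pow_const q).ennreal_ofReal
  have hmain := lintegral_coordRange_rpow_le (hcen hX hVX) (hcen hY hVY)
    (fun i j => by rw [hsq hVX, hsq hVY]; exact hinc i j) hq
  rw [hmap hVX, hmap hVY] at hmain
  calc ∫⁻ ω, (⨆ t ∈ I, ENNReal.ofReal |X t ω|) ^ q ∂P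
      ≤ ∫⁻ ω, ENNReal.ofReal (coordRange (V X ω)) ^ q ∂P := by
        refine lintegral_mono fun ω => ENNReal.rpow_le_rpow (iSup₂_le fun t ht => ?_) hq0
        refine ENNReal.ofReal_le_ofReal (abs_le'.2 ⟨?_, ?_⟩)
        · simpa [V, h0] using sub_le_coordRange (V X ω) ⟨t, ht⟩ ⟨t₀, hI⟩
        · simpa [V, h0] using sub_le_coordRange (V X ω) ⟨t₀, hI⟩ ⟨t, ht⟩
    _ ≤ ∫⁻ ω, ENNReal.ofReal (coordRange (V Y ω)) ^ q ∂P := hmain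
    _ ≤ ∫⁻ ω, 2 ^ q * (supAbs Y ω) ^ q ∂P := by
        refine lintegral_mono fun ω => ?_
        rw [← ENNReal.mul_rpow_of_nonneg _ _ hq0]
        refine ENNReal.rpow_le_rpow ?_ hq0
        obtain ⟨i, j, hij⟩ := exists_coordRange_eq (V Y ω)
        rw [hij, two_mul]
        calc ENNReal.ofReal (V Y ω i - V Y ω j)
            ≤ ENNReal.ofReal (|Y i ω| + |Y j ω|) :=
              ENNReal.ofReal_le_ofReal ((le_abs_self _).trans (abs_sub _ _))
          _ ≤ ENNReal.ofReal |Y i ω| + ENNReal.ofReal |Y j ω| := ENNReal.ofReal_add_le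
          _ ≤ _ := add_le_add (ofReal_abs_le_supAbs Y _ ω) (ofReal_abs_le_supAbs Y _ ω)
    _ = _ := lintegral_const_mul' _ _ (ENNReal.rpow_ne_top_of_nonneg hq0 (by simp))

section GaussianSum

variable {E Ω : Type*} [NormedAddCommGroup E] [NormedSpace ℝ E] [MeasurableSpace Ω]
  {P : Measure Ω} {M : ℕ} {g : Fin M → Ω → ℝ}

theorem isCenteredGaussianFamily_gaussianSum (hg : IsOrthogaussian g P) (Ψ : ℝ × ℝ → ℝ)
    (x y : Fin M → E) : IsCenteredGaussianFamily (gaussianSum g Ψ x y) P where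
  isGaussianProcess := by
    refine ⟨fun I => ?_⟩
    have h := hg.iIndepFun.hasGaussianLaw fun j => (hg.hasLaw j).hasGaussianLaw
    have := h.map_fun (ContinuousLinearMap.pi fun f : I => coordForm fun j =>
      Ψ (f.1.1 (x j), f.1.1 (y j)))
    refine this.congr (ae_of_all _ fun ω => ?_)
    ext f
    simp [gaussianSum, mul_comm]
  integral_eq_zero f := by
    have hi : ∀ j, Integrable (g j) P := fun j => (hg.hasLaw j).hasGaussianLaw.integrable
    have hz : ∀ j, ∫ ω, g j ω ∂P = 0 := fun j => by
      rw [(hg.hasLaw j).integral_eq, integral_id_gaussianReal]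
    simp only [gaussianSum]
    rw [integral_finsetSum _ fun j _ => (hi j).mul_const _]
    simp [integral_mul_const, hz]

end GaussianSum

/-- The supremum of the process `gaussianSum` is attained along a sequence of functionals that does
not depend on the sample point. -/
theorem exists_seq_supAbs_gaussianSum {E Ω : Type*} [NormedAddCommGroup E] [NormedSpace ℝ E]
    {M : ℕ} (g : Fin M → Ω → ℝ) {Ψ : ℝ × ℝ → ℝ} (hΨ : Continuous Ψ)
    (x y : Fin M → E) : ∃ F : ℕ → DualUnitBall E, ∀ ω,
      supAbs (gaussianSum g Ψ x y) ω = ⨆ n, ENNReal.ofReal |gaussianSum g Ψ x y (F n) ω| := by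
  let Φ : DualUnitBall E → Fin M → ℝ × ℝ := fun f j => (f.1 (x j), f.1 (y j))
  have : Nonempty (Set.range Φ) := ⟨⟨_, ⟨0, by simp⟩, rfl⟩⟩
  obtain ⟨u, hu⟩ := TopologicalSpace.exists_dense_seq (Set.range Φ)
  choose F hF using fun n => (u n).2
  refine ⟨F, fun ω => le_antisymm (iSup_le fun f => ?_)
    (iSup_le fun n => ofReal_abs_le_supAbs _ _ ω)⟩
  let c : Set.range Φ → ℝ≥0∞ := fun z => ENNReal.ofReal |∑ j, g j ω * Ψ (z.1 j)|
  have hc : Continuous c := ENNReal.continuous_ofReal.comp <| continuous_abs.comp <|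
    continuous_finsetSum _ fun j _ => continuous_const.mul <|
      hΨ.comp ((continuous_apply j).comp continuous_subtype_val)
  refine hu.induction_on (p := fun z => c z ≤ ⨆ n, ENNReal.ofReal |gaussianSum g Ψ x y (F n) ω|)
    ⟨Φ f, f, rfl⟩ (isClosed_le hc continuous_const) fun n => ?_
  refine le_trans (le_of_eq ?_)
    (le_iSup (fun n => ENNReal.ofReal |gaussianSum g Ψ x y (F n) ω|) n)
  simp only [c, ← hF n]
  rfl

theorem mainTheorem7
    {E : Type*} [NormedAddCommGroup E] [NormedSpace ℝ E] [CompleteSpace E]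
    {Ω : Type*} [MeasurableSpace Ω] (P : Measure Ω) [IsProbabilityMeasure P] [P.IsComplete]
    (M : ℕ) (g : Fin M → Ω → ℝ) (hg : IsOrthogaussian g P)
    (Ψ : ℝ × ℝ → ℝ) (hΨ : Continuous Ψ) (hΨ0 : Ψ (0, 0) = 0)
    (x y : Fin M → E)
    (G₂ : DualUnitBall E → Ω → ℝ) (hG₂ : IsCenteredGaussianFamily G₂ P)
    (hinc : ∀ f h : DualUnitBall E,
      ∫ ω, |gaussianSum g Ψ x y f ω - gaussianSum g Ψ x y h ω| ^ 2 ∂P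
        ≤ ∫ ω, |G₂ f ω - G₂ h ω| ^ 2 ∂P) :
    IsCenteredGaussianFamily (gaussianSum g Ψ x y) P ∧
    AEMeasurable (supAbs (gaussianSum g Ψ x y)) P ∧
    ∀ q : ℝ, 1 ≤ q →
      ∫⁻ ω, (supAbs (gaussianSum g Ψ x y) ω) ^ q ∂P
        ≤ 2 ^ q * ∫⁻ ω, (supAbs G₂ ω) ^ q ∂P := by
  classical
  set G₁ := gaussianSum g Ψ x y with hG₁
  have hG := isCenteredGaussianFamily_gaussianSum hg Ψ x y
  obtain ⟨F, hF⟩ := exists_seq_supAbs_gaussianSum g hΨ x y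
  have hm : ∀ f, AEMeasurable (fun ω => ENNReal.ofReal |G₁ f ω|) P := fun f =>
    (continuous_abs.measurable.comp_aemeasurable (hG.isGaussianProcess.aemeasurable f)).ennreal_ofReal
  refine ⟨hG, ?_, fun q hq => ?_⟩
  · rw [show supAbs G₁ = fun ω => ⨆ n, ENNReal.ofReal |G₁ (F n) ω| from funext hF]
    exact AEMeasurable.iSup fun n => hm _
  have hq0 : 0 < q := zero_lt_one.trans_le hq
  let f₀ : DualUnitBall E := ⟨0, by simp⟩
  have h0 : ∀ ω, G₁ f₀ ω = 0 := fun ω => by simp [hG₁, gaussianSum, f₀, hΨ0]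
  let I : ℕ → Finset (DualUnitBall E) := fun n => insert f₀ ((Finset.range n).image F)
  have hImono : Monotone I := fun m n hmn =>
    Finset.insert_subset_insert _ (Finset.image_subset_image (Finset.range_mono hmn))
  let A : ℕ → Ω → ℝ≥0∞ := fun n ω => ⨆ t ∈ I n, ENNReal.ofReal |G₁ t ω|
  have hAmono : ∀ ω, Monotone fun n => A n ω := fun ω m n hmn =>
    biSup_mono fun t ht => hImono hmn ht
  have hAm : ∀ n, AEMeasurable (A n) P := fun n =>
    AEMeasurable.biSup _ (I n).countable_toSet fun t _ => hm t
  have hsup : ∀ ω, supAbs G₁ ω ≤ ⨆ n, A n ω := fun ω => by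
    rw [hF ω]
    refine iSup_le fun n => le_iSup_of_le (n + 1) ?_
    exact le_iSup₂ (f := fun t (_ : t ∈ I (n + 1)) => ENNReal.ofReal |G₁ t ω|) (F n)
      (Finset.mem_insert_of_mem (Finset.mem_image_of_mem F (Finset.self_mem_range_succ n)))
  calc ∫⁻ ω, (supAbs G₁ ω) ^ q ∂P
      ≤ ∫⁻ ω, ⨆ n, (A n ω) ^ q ∂P := lintegral_mono fun ω => by
        refine (ENNReal.rpow_le_rpow (hsup ω) hq0.le).trans (le_of_eq ?_)
        exact (ENNReal.orderIsoRpow q hq0).map_iSup _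
    _ = ⨆ n, ∫⁻ ω, (A n ω) ^ q ∂P :=
        lintegral_iSup' (fun n => (hAm n).pow_const q)
          (ae_of_all _ fun ω m n hmn => ENNReal.rpow_le_rpow (hAmono ω hmn) hq0.le)
    _ ≤ _ := iSup_le fun n =>
        lintegral_biSup_rpow_le hG hG₂ hinc h0 (Finset.mem_insert_self _ _) hq
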